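/- Let $F$ be a field of characteristic zero, $d\in F$ a non-square, $K=F(\sqrt d)$, $\overline F$ an algebraic closure of $F$ containing $K$, and $x\mapsto\overline x$ the non-trivial element of $\mathrm{Gal}(K/F)$. For $n\ge 0$ let $\mathfrak g=\mathfrak{su}(n,F,d)=\{A\in\mathfrak{sl}(n,K):\overline A^T+A=0\}$, a Lie algebra over $F$ with $\overline F\otimes_F\mathfrak g=\mathfrak{sl}(n,\overline F)$. Let $\mathfrak h$ be the diagonal Cartan subalgebra of $\mathfrak{sl}(n,\overline F)$, let $\alpha_i=\varepsilon_i-\varepsilon_{i+1}$ ($1\le i<n$) be the simple roots and $\Gamma$ the set of simple roots, let $(e_\alpha)$ be root vectors with $\mathrm{tr}(e_\alpha e_{-\alpha})=1$ for all roots $\alpha$, and let $\Omega_0\in\mathfrak h\otimes\mathfrak h$ be the Cartan part of the Casimir element of the trace form. An admissible triple $(\Gamma_1,\Gamma_2,\tau)$ consists of subsets $\Gamma_1,\Gamma_2\subseteq\Gamma$ and an isometric bijection $\tau:\Gamma_1\to\Gamma_2$ such that for every $\alpha\in\Gamma_1$ there is $k$ with $\tau^k(\alpha)\notin\Gamma_1$.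 A Belavin–Drinfeld $r$-matrix with associated admissible triple $(\Gamma_1,\Gamma_2,\tau)$ is a solution $r_{BD}=r_0+r_1$ of the classical Yang–Baxter equation, where $r_0\in\mathfrak h\otimes\mathfrak h$ satisfies $r_0+r_0^{21}=\Omega_0$ and $(\tau(\alpha)\otimes\mathrm{Id}+\mathrm{Id}\otimes\alpha)(r_0)=0$ for all $\alpha\in\Gamma_1$, and $$r_1=\sum_{\alpha>0}e_\alpha\otimes e_{-\alpha}+\sum_{\alpha\in\mathrm{Span}(\Gamma_1)^+}\ \sum_{k\ge1}e_\alpha\wedge e_{-\tau^k(\alpha)},$$ with $a\wedge b=a\otimes b-b\otimes a$, where $\tau$ is extended additively to $\mathrm{Span}(\Gamma_1)$ and the inner sum runs over those $k$ for which $\tau^k(\alpha)$ is defined. The Drinfeld–Jimbo $r$-matrix is $r_{DJ}=\frac12\Omega_0+\sum_{\alpha>0}e_\alpha\otimes e_{-\alpha}$. Let $d'\in F$ and let $\sqrt{d'}\in\overline F$ be a square root of $d'$ with $\sqrt{d'}\notin K$. Let $X\in\mathrm{GL}(n,\overline F)$, let $r_{BD}$ be a Belavin–Drinfeld $r$-matrix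 over $\overline F$ with associated admissible triple $(\Gamma_1,\Gamma_2,\tau)$, and put $r=\sqrt{d'}\,(\mathrm{Ad}_X\otimes\mathrm{Ad}_X)(r_{BD})$. Suppose that $\partial r:a\mapsto[r,a\otimes1+1\otimes a]$ defines a Lie bialgebra structure on $\mathfrak g$, i.e. maps $\mathfrak g$ into $\mathfrak g\otimes_F\mathfrak g$ and is a Lie bialgebra structure on the $F$-Lie algebra $\mathfrak g$. Then $\Gamma_1=\Gamma_2=\emptyset$. Consequently $r_{BD}=r_s+r_{DJ}$ for some $r_s\in\mathfrak h\otimes\mathfrak h$ with $r_s+r_s^{21}=0$. -/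

import Mathlib

open scoped TensorProduct

noncomputable section

attribute [local instance 100] LieRing.ofAssociativeRing

/-! ### Lie bialgebras -/

/-- The bilinear operation on the dual of `L` obtained as the transpose of `δ : L → L ⊗ L`:
`[f, g](x) = (f ⊗ g)(δ x)`. -/
def dualBracket {R L : Type*} [CommRing R] [AddCommGroup L] [Module R L]
    (δ : L →ₗ[R] L ⊗[R] L) (f g : Module.Dual R L) : Module.Dual R L :=
  (TensorProduct.dualDistrib R L L (f ⊗ₜ[R] g)) ∘ₗ δ

/-- `δ` is a Lie coalgebra structure on the (finite-dimensional) space `L`: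
its transpose is a Lie bracket on the dual space. -/
structure IsLieCoalgebra {R L : Type*} [CommRing R] [AddCommGroup L] [Module R L]
    (δ : L →ₗ[R] L ⊗[R] L) : Prop where
  bracket_self : ∀ f : Module.Dual R L, dualBracket δ f f = 0
  jacobi : ∀ f g h : Module.Dual R L,
    dualBracket δ f (dualBracket δ g h) + dualBracket δ g (dualBracket δ h f)
      + dualBracket δ h (dualBracket δ f g) = 0

/-- `δ` is a Lie bialgebra structure on the Lie algebra `L`. Here `⁅a, t⁆` for `t ∈ L ⊗ L` is
the natural action `(ad_a ⊗ 1 + 1 ⊗ ad_a) t`. -/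
structure IsLieBialgebra {R L : Type*} [CommRing R] [LieRing L] [LieAlgebra R L]
    (δ : L →ₗ[R] L ⊗[R] L) : Prop where
  coalgebra : IsLieCoalgebra δ
  cocycle : ∀ a b : L, δ ⁅a, b⁆ = ⁅a, δ b⁆ - ⁅b, δ a⁆

/-! ### The Lie algebra `su(n, F, d)` -/

/-- The `F`-Lie algebra of all trace zero `n × n` matrices `A` over `K` with `Āᵀ + A = 0`,
where the bar is the entrywise action of the automorphism `conj` of `K` over `F`. -/
def su {F K : Type*} [Field F] [Field K] [Algebra F K] (n : ℕ) (conj : K ≃ₐ[F] K) :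
    LieSubalgebra F (Matrix (Fin n) (Fin n) K) where
  carrier := {A | A.trace = 0 ∧ (A.map conj).transpose + A = 0}
  zero_mem' := by
    refine ⟨by simp, ?_⟩
    ext i j; simp
  add_mem' := by
    rintro A B ⟨hA, hA'⟩ ⟨hB, hB'⟩
    refine ⟨by simp [hA, hB], ?_⟩
    ext i j
    have h1 := congrFun (congrFun hA' i) j
    have h2 := congrFun (congrFun hB' i) j
    simp at h1 h2 ⊢
    linear_combination h1 + h2
  smul_mem' := by
    rintro c A ⟨hA, hA'⟩
    refine ⟨by simp [hA], ?_⟩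
    ext i j
    have h1 := congrFun (congrFun hA' i) j
    simp only [Matrix.add_apply, Matrix.transpose_apply, Matrix.map_apply, Matrix.smul_apply,
      Matrix.zero_apply, map_smul] at h1 ⊢
    rw [← smul_add, h1, smul_zero]
  lie_mem' := by
    rintro A B ⟨hA, hA'⟩ ⟨hB, hB'⟩
    refine ⟨by simp [Ring.lie_def, Matrix.trace_sub, Matrix.trace_mul_comm A B], ?_⟩
    have eA : (A.map conj).transpose = -A := eq_neg_of_add_eq_zero_left hA'
    have eB : (B.map conj).transpose = -B := eq_neg_of_add_eq_zero_left hB'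
    have hm : ∀ C D : Matrix (Fin n) (Fin n) K,
        ((C * D).map conj).transpose = (D.map conj).transpose * (C.map conj).transpose := by
      intro C D
      rw [← Matrix.transpose_mul]
      congr 1
      ext i j
      simp [Matrix.mul_apply]
    have hs : ((A * B - B * A).map conj).transpose
        = ((A * B).map conj).transpose - ((B * A).map conj).transpose := by
      ext i j; simp only [Matrix.sub_apply, Matrix.transpose_apply, Matrix.map_apply, map_sub]
    rw [Ring.lie_def, hs, hm, hm, eA, eB]
    simp

/-! ### Tensors over the matrix algebra -/

/-- The algebra `M_n(k) ⊗ M_n(k)`, containing `sl(n, k) ⊗ sl(n, k)`. -/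
abbrev Mat2 (n : ℕ) (k : Type*) [Field k] : Type _ :=
  Matrix (Fin n) (Fin n) k ⊗[k] Matrix (Fin n) (Fin n) k

/-- The flip `a ⊗ b ↦ b ⊗ a`, i.e. `r ↦ r²¹`. -/
def flip21 {n : ℕ} {k : Type*} [Field k] (r : Mat2 n k) : Mat2 n k :=
  TensorProduct.comm k _ _ r

/-- `(Ad_X ⊗ Ad_X)(r) = (X ⊗ X) r (X⁻¹ ⊗ X⁻¹)`. -/
def adAd {n : ℕ} {k : Type*} [Field k] (X : GL (Fin n) k) (r : Mat2 n k) : Mat2 n k :=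
  ((X : Matrix (Fin n) (Fin n) k) ⊗ₜ[k] (X : Matrix (Fin n) (Fin n) k)) * r *
    (((X⁻¹ : GL (Fin n) k) : Matrix (Fin n) (Fin n) k) ⊗ₜ[k]
      ((X⁻¹ : GL (Fin n) k) : Matrix (Fin n) (Fin n) k))

/-- The coboundary `∂r (a) = [r, a ⊗ 1 + 1 ⊗ a]`. -/
def coboundary {n : ℕ} {k : Type*} [Field k] (r : Mat2 n k) (a : Matrix (Fin n) (Fin n) k) :
    Mat2 n k :=
  r * (a ⊗ₜ[k] 1 + 1 ⊗ₜ[k] a) - (a ⊗ₜ[k] 1 + 1 ⊗ₜ[k] a) * r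

/-- The Yang-Baxter operator `[r₁₂, r₁₃] + [r₁₂, r₂₃] + [r₁₃, r₂₃]`. -/
def CYB {n : ℕ} {k : Type*} [Field k] (r : Mat2 n k) :
    Matrix (Fin n) (Fin n) k ⊗[k] Mat2 n k :=
  let r₁₂ := Algebra.TensorProduct.map (AlgHom.id k (Matrix (Fin n) (Fin n) k))
    (Algebra.TensorProduct.includeLeft :
      Matrix (Fin n) (Fin n) k →ₐ[k] Mat2 n k) r
  let r₁₃ := Algebra.TensorProduct.map (AlgHom.id k (Matrix (Fin n) (Fin n) k))
    (Algebra.TensorProduct.includeRight :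
      Matrix (Fin n) (Fin n) k →ₐ[k] Mat2 n k) r
  let r₂₃ := (Algebra.TensorProduct.includeRight :
    Mat2 n k →ₐ[k] Matrix (Fin n) (Fin n) k ⊗[k] Mat2 n k) r
  (r₁₂ * r₁₃ - r₁₃ * r₁₂) + (r₁₂ * r₂₃ - r₂₃ * r₁₂) + (r₁₃ * r₂₃ - r₂₃ * r₁₃)

/-! ### `∂r` as a Lie bialgebra structure on `su(n, F, d)` -/

/-- The natural map `su ⊗_F su → M_n(k) ⊗_k M_n(k)` for an extension `k` of `K`. -/
def suTensor {F K : Type*} (k : Type*) [Field F] [Field K] [Field k] [Algebra F K] [Algebra F k]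
    [Algebra K k] [IsScalarTower F K k] (n : ℕ) (conj : K ≃ₐ[F] K) :
    (su n conj) ⊗[F] (su n conj) →ₗ[F] Mat2 n k :=
  TensorProduct.lift <| LinearMap.mk₂ F
    (fun a b : su n conj =>
      (a : Matrix (Fin n) (Fin n) K).map (algebraMap K k) ⊗ₜ[k]
        (b : Matrix (Fin n) (Fin n) K).map (algebraMap K k))
    (by intro a b c; simp [Matrix.map_add, TensorProduct.add_tmul])
    (by
      intro c a b
      have h : ((c • a : su n conj) : Matrix (Fin n) (Fin n) K).map (algebraMap K k)
          = c • (a : Matrix (Fin n) (Fin n) K).map (algebraMap K k) := by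
        ext i j
        exact map_smul (IsScalarTower.toAlgHom F K k) c ((a : Matrix (Fin n) (Fin n) K) i j)
      rw [h, TensorProduct.smul_tmul'])
    (by intro a b c; simp [Matrix.map_add, TensorProduct.tmul_add])
    (by
      intro c a b
      have h : ((c • b : su n conj) : Matrix (Fin n) (Fin n) K).map (algebraMap K k)
          = (algebraMap F k c) • (b : Matrix (Fin n) (Fin n) K).map (algebraMap K k) := by
        ext i j
        rw [algebraMap_smul]
        exact map_smul (IsScalarTower.toAlgHom F K k) c ((b : Matrix (Fin n) (Fin n) K) i j)
      rw [h, TensorProduct.tmul_smul, algebraMap_smul])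

/-- `∂r` defines a Lie bialgebra structure on `su(n, F, d)`: it restricts to a map
`su → su ⊗_F su` which is a Lie bialgebra structure. -/
def DefinesLieBialgebra {F K k : Type*} [Field F] [Field K] [Field k] [Algebra F K] [Algebra F k]
    [Algebra K k] [IsScalarTower F K k] {n : ℕ} (conj : K ≃ₐ[F] K) (r : Mat2 n k) : Prop :=
  ∃ δ : su n conj →ₗ[F] (su n conj) ⊗[F] (su n conj), IsLieBialgebra δ ∧
    ∀ a : su n conj, suTensor k n conj (δ a) =
      coboundary r ((a : Matrix (Fin n) (Fin n) K).map (algebraMap K k))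

/-! ### Belavin-Drinfeld `r`-matrices for `sl(n)`

The Cartan subalgebra is the diagonal one, and the root `ε_i - ε_j` is encoded by the pair `(i, j)`;
it is positive if `i < j`. The simple roots are `α_i = ε_i - ε_{i+1}` for `i : Fin (n - 1)`. -/

/-- An admissible triple `(Γ₁, Γ₂, τ)` in the set of simple roots of `sl(n)`.
Only the values of `τ` on `Γ₁` are relevant. -/
structure AdmissibleTriple (n : ℕ) where
  Γ₁ : Finset (Fin (n - 1))
  Γ₂ : Finset (Fin (n - 1))
  τ : Fin (n - 1) → Fin (n - 1)
  bijOn : Set.BijOn τ Γ₁ Γ₂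
  isometric : ∀ i ∈ Γ₁, ∀ j ∈ Γ₁, CartanMatrix.A (n - 1) (τ i) (τ j) = CartanMatrix.A (n - 1) i j
  nilpotent : ∀ i ∈ Γ₁, ∃ m : ℕ, τ^[m] i ∉ Γ₁

/-- The set of simple roots whose sum is the positive root `ε_i - ε_j = α_i + ⋯ + α_{j-1}`. -/
def rootSupport {n : ℕ} (p : Fin n × Fin n) : Finset (Fin (n - 1)) :=
  Finset.univ.filter fun l => p.1.val ≤ l.val ∧ l.val < p.2.val

/-- For positive roots `p`, `q`: `p` lies in `Span(Γ₁)⁺` and `q = τ^m (p)` for some `m ≥ 1` for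
which `τ^m (p)` is defined, `τ` being extended additively to `Span(Γ₁)`. Since `τ` is nilpotent,
`m` is then unique, so that a sum over pairs `p ≺ q` is a sum over `p` and `m`. -/
def AdmissibleTriple.Precedes {n : ℕ} (T : AdmissibleTriple n) (p q : Fin n × Fin n) : Prop :=
  ∃ m : ℕ, 1 ≤ m ∧ (∀ l < m, (rootSupport p).image (T.τ^[l]) ⊆ T.Γ₁) ∧
    rootSupport q = (rootSupport p).image (T.τ^[m])

/-- The positive roots of `sl(n)`. -/
def posRoots (n : ℕ) : Finset (Fin n × Fin n) := Finset.univ.filter fun p => p.1 < p.2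

/-- The root vector `c i j • E_{ij}` for the root `ε_i - ε_j`. -/
def rootVector {n : ℕ} {k : Type*} [Field k] (c : Fin n → Fin n → k) (p : Fin n × Fin n) :
    Matrix (Fin n) (Fin n) k :=
  Matrix.single p.1 p.2 (c p.1 p.2)

/-- The wedge `a ∧ b = a ⊗ b - b ⊗ a`. -/
def wedge {n : ℕ} {k : Type*} [Field k] (a b : Matrix (Fin n) (Fin n) k) : Mat2 n k :=
  a ⊗ₜ[k] b - b ⊗ₜ[k] a

/-- The traceless diagonal matrices. -/
def cartan (n : ℕ) (k : Type*) [Field k] : Submodule k (Matrix (Fin n) (Fin n) k) where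
  carrier := {A | A.IsDiag ∧ A.trace = 0}
  zero_mem' := ⟨Matrix.isDiag_zero, by simp⟩
  add_mem' := fun hA hB => ⟨hA.1.add hB.1, by simp [hA.2, hB.2]⟩
  smul_mem' := fun c _ hA => ⟨hA.1.smul c, by simp [hA.2]⟩

/-- `𝔥 ⊗ 𝔥` inside `M_n(k) ⊗ M_n(k)`. -/
def cartanTensor (n : ℕ) (k : Type*) [Field k] : Submodule k (Mat2 n k) :=
  LinearMap.range (TensorProduct.map (cartan n k).subtype (cartan n k).subtype)

/-- The Cartan part `Ω₀` of the Casimir element of `sl(n)` with respect to the trace form,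
i.e. `∑ h_i ⊗ h_i` for an orthonormal basis `(h_i)` of the Cartan subalgebra. -/
def casimirCartan (n : ℕ) (k : Type*) [Field k] : Mat2 n k :=
  ∑ i : Fin n, Matrix.single i i (1 : k) ⊗ₜ[k] Matrix.single i i (1 : k) - (n : k)⁻¹ • 1

/-- The simple root `α_i` as a functional: `A ↦ A_{i,i} - A_{i+1,i+1}`. -/
def simpleRoot {n : ℕ} (k : Type*) [Field k] (i : Fin (n - 1)) :
    Matrix (Fin n) (Fin n) k →ₗ[k] k :=
  Matrix.entryLinearMap k k ⟨i.val, by omega⟩ ⟨i.val, by omega⟩ -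
    Matrix.entryLinearMap k k ⟨i.val + 1, by omega⟩ ⟨i.val + 1, by omega⟩

/-- `(f ⊗ Id + Id ⊗ g)(r)`, an element of `M_n(k) = k ⊗ M_n(k) = M_n(k) ⊗ k`. -/
def contract {n : ℕ} {k : Type*} [Field k] (f g : Matrix (Fin n) (Fin n) k →ₗ[k] k)
    (r : Mat2 n k) : Matrix (Fin n) (Fin n) k :=
  TensorProduct.lid k _ (LinearMap.rTensor _ f r) + TensorProduct.rid k _ (LinearMap.lTensor _ g r)

open scoped Classical in
/-- The tensor
`r₁ = ∑_{α > 0} e_α ⊗ e_{-α} + ∑_{α ∈ Span(Γ₁)⁺} ∑_{m ≥ 1} e_α ∧ e_{-τ^m(α)}`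
for the root vectors `e_α` given by `c`. -/
def bdRootPart {n : ℕ} {k : Type*} [Field k] (T : AdmissibleTriple n) (c : Fin n → Fin n → k) :
    Mat2 n k :=
  ∑ p ∈ posRoots n, rootVector c p ⊗ₜ[k] rootVector c p.swap +
    ∑ p ∈ posRoots n, ∑ q ∈ (posRoots n).filter (fun q => T.Precedes p q),
      wedge (rootVector c p) (rootVector c q.swap)

/-- `r` is a Belavin-Drinfeld `r`-matrix of `sl(n, k)` with associated admissible triple `T`:
a solution of the classical Yang-Baxter equation of the form `r₀ + r₁` as in the Belavin-Drinfeld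
classification, the root vectors being normalized by `tr(e_α e_{-α}) = 1`. -/
def IsBelavinDrinfeld {n : ℕ} {k : Type*} [Field k] (T : AdmissibleTriple n) (r : Mat2 n k) :
    Prop :=
  ∃ (c : Fin n → Fin n → k) (r₀ : Mat2 n k),
    (∀ i j, i ≠ j → c i j * c j i = 1) ∧
    r₀ ∈ cartanTensor n k ∧
    r₀ + flip21 r₀ = casimirCartan n k ∧
    (∀ i ∈ T.Γ₁, contract (simpleRoot k (T.τ i)) (simpleRoot k i) r₀ = 0) ∧
    r = r₀ + bdRootPart T c ∧
    CYB r = 0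

/-- The Drinfeld-Jimbo `r`-matrix `½ Ω₀ + ∑_{i < j} E_{ij} ⊗ E_{ji}`. -/
def drinfeldJimbo (n : ℕ) (k : Type*) [Field k] : Mat2 n k :=
  (2 : k)⁻¹ • casimirCartan n k +
    ∑ p ∈ posRoots n, Matrix.single p.1 p.2 (1 : k) ⊗ₜ[k] Matrix.single p.2 p.1 (1 : k)

end

/-! Write s = √d' and R = s·(Ad_X ⊗ Ad_X)(r_BD). Choose σ in Gal(F̄/F) extending the conjugation of
K with σ(s) = -s (`exists_algEquiv_extending`). Elements a of su satisfy σ(a) = -aᵀ, so on su ⊗ su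
the action of σ is transposition of both legs. Applied to the values of ∂R, this makes σ(R) -
R^{T⊗T} commute with the diagonal action of gl_n, hence symmetric (`flipLinear_conj_sub_transpose`).
Since R + R²¹ is s times the Casimir element and σ negates it, σ(R) = -(R²¹)^{T⊗T}; that is, Y =
Xᵀσ(X) conjugates σ(r_BD) into (r_BD²¹)^{T⊗T} (`intertwine_of_symmetric`).

The first tensor has the triple (Γ₁, Γ₂, τ); transposing and flipping reverses the roles of Γ₁ and
Γ₂. The two are compared through the spans of their first legs. Both contain only those negative
root vectors allowed by Γ₂, respectively Γ₁. If α_m ∉ Γ₁, the second span stabilizes the standard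
flag member V of dimension m + 1. Then Y⁻¹V is stable under the first span, which contains all E_ij
with i < j (`single_mem_range_leg`), so Y⁻¹V is itself a standard flag member, of the same
dimension: it is V (`leg_mem_blockUpper_of_intertwine`). Thus the first span stabilizes V and α_m ∉
Γ₂ (`notMem_of_leg_mem_blockUpper`). Hence Γ₂ ⊆ Γ₁, and nilpotence of τ empties both. -/

noncomputable section

/-! ### Symmetries of M_n ⊗ M_n and the commutant of the diagonal action. -/

section Tensor

variable {n : ℕ} {k : Type*} [Field k]

/-- The entrywise action of a field automorphism on matrices, as a semilinear map. -/
def matrixConj (n : ℕ) {k : Type*} [Field k] (σ : k →+* k) :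
    Matrix (Fin n) (Fin n) k →ₛₗ[σ] Matrix (Fin n) (Fin n) k where
  toFun A := A.map σ
  map_add' A B := by ext; simp
  map_smul' c A := by ext; simp

@[simp] lemma matrixConj_apply (σ : k →+* k) (A : Matrix (Fin n) (Fin n) k) :
    matrixConj n σ A = A.map σ := rfl

/-- The action of a field automorphism on `M_n ⊗ M_n`. -/
def tensorConj (n : ℕ) {k : Type*} [Field k] (σ : k →+* k) : Mat2 n k →ₛₗ[σ] Mat2 n k :=
  TensorProduct.map (matrixConj n σ) (matrixConj n σ)

@[simp] lemma tensorConj_tmul (σ : k →+* k) (a b : Matrix (Fin n) (Fin n) k) :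
    tensorConj n σ (a ⊗ₜ b) = a.map σ ⊗ₜ b.map σ := rfl

/-- Transposition of both legs of a tensor. -/
def tensorTranspose (n : ℕ) (k : Type*) [Field k] : Mat2 n k →ₗ[k] Mat2 n k :=
  TensorProduct.map (Matrix.transposeLinearEquiv (Fin n) (Fin n) k k).toLinearMap
    (Matrix.transposeLinearEquiv (Fin n) (Fin n) k k).toLinearMap

@[simp] lemma tensorTranspose_tmul (a b : Matrix (Fin n) (Fin n) k) :
    tensorTranspose n k (a ⊗ₜ b) = a.transpose ⊗ₜ b.transpose := rfl

/-- The flip as a linear map. -/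
def flipLinear (n : ℕ) (k : Type*) [Field k] : Mat2 n k →ₗ[k] Mat2 n k :=
  (TensorProduct.comm k _ _).toLinearMap

lemma flip21_eq (r : Mat2 n k) : flip21 r = flipLinear n k r := rfl

@[simp] lemma flipLinear_tmul (a b : Matrix (Fin n) (Fin n) k) :
    flipLinear n k (a ⊗ₜ b) = b ⊗ₜ a := rfl

lemma tensorConj_mul (σ : k →+* k) (r s : Mat2 n k) :
    tensorConj n σ (r * s) = tensorConj n σ r * tensorConj n σ s := by
  induction r using TensorProduct.induction_on with
  | zero => simp
  | add x y hx hy => simp [add_mul, hx, hy]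
  | tmul a b =>
    induction s using TensorProduct.induction_on with
    | zero => simp
    | add x y hx hy => simp only [mul_add, map_add, hx, hy]
    | tmul c d => simp [Matrix.map_mul]

lemma tensorTranspose_mul (r s : Mat2 n k) :
    tensorTranspose n k (r * s) = tensorTranspose n k s * tensorTranspose n k r := by
  induction r using TensorProduct.induction_on with
  | zero => simp
  | add x y hx hy => simp only [add_mul, mul_add, map_add, hx, hy]
  | tmul a b =>
    induction s using TensorProduct.induction_on with
    | zero => simp
    | add x y hx hy => simp only [add_mul, mul_add, map_add, hx, hy]
    | tmul c d => simp [Matrix.transpose_mul]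

lemma flipLinear_mul (r s : Mat2 n k) :
    flipLinear n k (r * s) = flipLinear n k r * flipLinear n k s := by
  induction r using TensorProduct.induction_on with
  | zero => simp
  | add x y hx hy => simp only [add_mul, map_add, hx, hy]
  | tmul a b =>
    induction s using TensorProduct.induction_on with
    | zero => simp
    | add x y hx hy => simp only [mul_add, map_add, hx, hy]
    | tmul c d => simp

lemma flipLinear_flipLinear (r : Mat2 n k) : flipLinear n k (flipLinear n k r) = r := by
  simp [flipLinear]

lemma flipLinear_tensorConj (σ : k →+* k) (r : Mat2 n k) :
    flipLinear n k (tensorConj n σ r) = tensorConj n σ (flipLinear n k r) := by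
  induction r using TensorProduct.induction_on with
  | zero => simp
  | add x y hx hy => simp only [map_add, hx, hy]
  | tmul a b => simp

lemma flipLinear_tensorTranspose (r : Mat2 n k) :
    flipLinear n k (tensorTranspose n k r) = tensorTranspose n k (flipLinear n k r) := by
  induction r using TensorProduct.induction_on with
  | zero => simp
  | add x y hx hy => simp only [map_add, hx, hy]
  | tmul a b => simp

/-- The tensor `∑ E_{ij} ⊗ E_{ji}`. -/
def permTensor (n : ℕ) (k : Type*) [Field k] : Mat2 n k :=
  ∑ i : Fin n, ∑ j : Fin n, Matrix.single i j (1 : k) ⊗ₜ[k] Matrix.single j i (1 : k)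

lemma single_mul_single_ite (i j p q : Fin n) (u v : k) :
    Matrix.single i j u * Matrix.single p q v =
      if j = p then Matrix.single i q (u * v) else 0 := by
  split_ifs with h
  · subst h; simp
  · simp [h]

/-- `permTensor` is the swap operator on kⁿ ⊗ kⁿ, so conjugation by it exchanges the legs. By
bilinearity, matrix units suffice. -/
lemma permTensor_mul_tmul (a b : Matrix (Fin n) (Fin n) k) :
    permTensor n k * (a ⊗ₜ b) = (b ⊗ₜ a) * permTensor n k := by
  induction a using Matrix.induction_on' with
  | h_zero => simp
  | h_add a a' h h' => simp only [TensorProduct.add_tmul, TensorProduct.tmul_add, mul_add, add_mul, h, h']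
  | h_std_basis p q u =>
    induction b using Matrix.induction_on' with
    | h_zero => simp
    | h_add a a' h h' => simp only [TensorProduct.add_tmul, TensorProduct.tmul_add, mul_add, add_mul, h, h']
    | h_std_basis s t v =>
      simp only [permTensor, Finset.sum_mul, Finset.mul_sum, Algebra.TensorProduct.tmul_mul_tmul,
        single_mul_single_ite, TensorProduct.ite_tmul, TensorProduct.tmul_ite, one_mul, mul_one]
      simp only [Finset.sum_ite_eq, Finset.sum_ite_eq', Finset.mem_univ, if_true, Finset.sum_ite_irrel,
        Finset.sum_const_zero]
      have h : ∀ (i j : Fin n) (w : k), Matrix.single i j w = w • Matrix.single i j (1 : k) := by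
        intros; simp
      rw [h s q, h p t, h s q v, h p t u, TensorProduct.smul_tmul, TensorProduct.smul_tmul, smul_comm]

lemma permTensor_mul (r : Mat2 n k) :
    permTensor n k * r = flipLinear n k r * permTensor n k := by
  induction r using TensorProduct.induction_on with
  | zero => simp
  | add x y hx hy => simp only [mul_add, add_mul, map_add, hx, hy]
  | tmul a b => simp [permTensor_mul_tmul]

lemma permTensor_mul_self : permTensor n k * permTensor n k = 1 := by
  simp only [permTensor, Finset.sum_mul, Finset.mul_sum, Algebra.TensorProduct.tmul_mul_tmul,
    single_mul_single_ite, TensorProduct.ite_tmul, TensorProduct.tmul_ite, one_mul]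
  simp only [Finset.sum_ite_eq', Finset.mem_univ, if_true, Finset.sum_ite_irrel,
        Finset.sum_const_zero]
  simp only [← TensorProduct.tmul_sum, ← TensorProduct.sum_tmul, Matrix.sum_single_one]
  rfl

@[simp] lemma tensorConj_permTensor (σ : k →+* k) :
    tensorConj n σ (permTensor n k) = permTensor n k := by
  simp [permTensor, Matrix.map_single]

@[simp] lemma tensorTranspose_permTensor :
    tensorTranspose n k (permTensor n k) = permTensor n k := by
  simp only [permTensor, map_sum, tensorTranspose_tmul, Matrix.transpose_single]
  exact Finset.sum_comm

@[simp] lemma tensorConj_one (σ : k →+* k) : tensorConj n σ 1 = 1 := by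
  simp [Algebra.TensorProduct.one_def]

@[simp] lemma tensorTranspose_one : tensorTranspose n k 1 = 1 := by
  simp [Algebra.TensorProduct.one_def]

/-- The diagonal action `a ⊗ 1 + 1 ⊗ a`. -/
def diagTensor (n : ℕ) (k : Type*) [Field k] : Matrix (Fin n) (Fin n) k →ₗ[k] Mat2 n k where
  toFun a := a ⊗ₜ[k] 1 + 1 ⊗ₜ[k] a
  map_add' a b := by rw [TensorProduct.add_tmul, TensorProduct.tmul_add]; abel
  map_smul' c a := by simp [TensorProduct.smul_tmul']

lemma diagTensor_apply (a : Matrix (Fin n) (Fin n) k) :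
    diagTensor n k a = a ⊗ₜ[k] 1 + 1 ⊗ₜ[k] a := rfl

lemma diagTensor_mul (a b : Matrix (Fin n) (Fin n) k) :
    diagTensor n k a * diagTensor n k b =
      diagTensor n k (a * b) + (a ⊗ₜ[k] b + b ⊗ₜ[k] a) := by
  simp only [diagTensor_apply, add_mul, mul_add, Algebra.TensorProduct.tmul_mul_tmul, mul_one,
    one_mul]
  abel

/-- A tensor commuting with the diagonal action of `gl_n` is symmetric. -/
lemma flipLinear_eq_self_of_commute [CharZero k] (D : Mat2 n k)
    (hD : ∀ a, Commute D (diagTensor n k a)) : flipLinear n k D = D := by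
  -- With Δ = `diagTensor`, Δ(a)Δ(b) - Δ(ab) = a ⊗ b + b ⊗ a. Symmetrizing the swap operator writes
  -- twice it as a sum of such terms, so D commutes with the swap, and conjugation by the swap is
  -- the flip.
  have h1 : ∀ a b : Matrix (Fin n) (Fin n) k, Commute D (a ⊗ₜ[k] b + b ⊗ₜ[k] a) := by
    intro a b
    have h := ((hD a).mul_right (hD b)).sub_right (hD (a * b))
    rwa [diagTensor_mul, add_sub_cancel_left] at h
  have h2 : Commute D ((2 : k) • permTensor n k) := by
    have h : (2 : k) • permTensor n k = ∑ i : Fin n, ∑ j : Fin n,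
        (Matrix.single i j (1 : k) ⊗ₜ[k] Matrix.single j i (1 : k) +
          Matrix.single j i (1 : k) ⊗ₜ[k] Matrix.single i j (1 : k)) := by
      simp only [Finset.sum_add_distrib]
      rw [two_smul]
      congr 1
      exact Finset.sum_comm
    rw [h]
    exact Commute.sum_right _ _ _ fun i _ => Commute.sum_right _ _ _ fun j _ => h1 _ _
  have h3 : Commute D (permTensor n k) := by
    have h := h2.smul_right (2 : k)⁻¹
    rwa [smul_smul, inv_mul_cancel₀ two_ne_zero, one_smul] at h
  have h4 : flipLinear n k D * permTensor n k = D * permTensor n k := by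
    rw [← permTensor_mul, h3.eq]
  calc flipLinear n k D = flipLinear n k D * permTensor n k * permTensor n k := by
        rw [mul_assoc, permTensor_mul_self, mul_one]
    _ = D := by rw [h4, mul_assoc, permTensor_mul_self, mul_one]

lemma adAd_add (X : GL (Fin n) k) (r s : Mat2 n k) : adAd X (r + s) = adAd X r + adAd X s := by
  simp [adAd, mul_add, add_mul]

lemma adAd_sub (X : GL (Fin n) k) (r s : Mat2 n k) : adAd X (r - s) = adAd X r - adAd X s := by
  simp [adAd, mul_sub, sub_mul]

lemma adAd_smul (X : GL (Fin n) k) (c : k) (r : Mat2 n k) : adAd X (c • r) = c • adAd X r := by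
  rw [adAd, adAd, mul_smul_comm, smul_mul_assoc]

lemma flipLinear_adAd (X : GL (Fin n) k) (r : Mat2 n k) :
    flipLinear n k (adAd X r) = adAd X (flipLinear n k r) := by
  simp [adAd, flipLinear_mul]

lemma adAd_one (X : GL (Fin n) k) : adAd X (1 : Mat2 n k) = 1 := by
  simp [adAd, Algebra.TensorProduct.one_def]

lemma adAd_permTensor (X : GL (Fin n) k) : adAd X (permTensor n k) = permTensor n k := by
  rw [adAd, ← flipLinear_tmul, ← permTensor_mul, mul_assoc]
  simp [← Algebra.TensorProduct.one_def]

end Tensor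

/-! ### Extending the conjugation of K to the algebraic closure. -/

/-- An automorphism of an algebraic closure of `F` that extends a given one of `K` and changes the
sign of an element outside `K` whose square lies in `F`. -/
lemma exists_algEquiv_extending {F K Fbar : Type*} [Field F] [CharZero F] [Field K] [Algebra F K]
    [Field Fbar] [Algebra F Fbar] [IsAlgClosure F Fbar] [Algebra K Fbar] [IsScalarTower F K Fbar]
    (conj : K ≃ₐ[F] K) (d' : F) (s : Fbar) (hs : s ^ 2 = algebraMap F Fbar d')
    (hs' : s ∉ Set.range (algebraMap K Fbar)) :
    ∃ σ : Fbar ≃ₐ[F] Fbar, (∀ x : K, σ (algebraMap K Fbar x) = algebraMap K Fbar (conj x)) ∧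
      σ s = -s := by
  have : CharZero K := charZero_of_injective_algebraMap (algebraMap F K).injective
  have : Algebra.IsAlgebraic F Fbar := IsAlgClosure.isAlgebraic
  have : Algebra.IsAlgebraic K Fbar := Algebra.IsAlgebraic.tower_top (K := F) K
  have : IsAlgClosed Fbar := IsAlgClosure.isAlgClosed F
  have : IsAlgClosure K Fbar := ⟨inferInstance, inferInstance⟩
  have : Normal F Fbar := IsAlgClosure.normal F Fbar
  have : Normal K Fbar := IsAlgClosure.normal K Fbar
  have : IsGalois K Fbar := {}
  have sign : ∀ σ : Fbar ≃ₐ[F] Fbar, σ s = s ∨ σ s = -s := by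
    intro σ
    apply sq_eq_sq_iff_eq_or_eq_neg.mp
    rw [← map_pow, hs, AlgEquiv.commutes]
  -- F̄/K is Galois, so an element fixed by its whole group would lie in K.
  have hex : ∃ φ : Fbar ≃ₐ[K] Fbar, φ s ≠ s := by
    by_contra! h
    exact hs' (IntermediateField.mem_bot.mp ((InfiniteGalois.mem_bot_iff_fixed s).mpr h))
  obtain ⟨φ, hφ⟩ := hex
  have hφs : φ s = -s := (sign (φ.restrictScalars F)).resolve_left hφ
  -- If the chosen lift of the conjugation fixes s, precompose it with φ, which is trivial on K and
  -- negates s.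
  rcases sign (conj.liftNormal Fbar) with h | h
  · refine ⟨(φ.restrictScalars F).trans (conj.liftNormal Fbar), fun x => ?_, ?_⟩
    · simp
    · simp [hφs, h]
  · exact ⟨conj.liftNormal Fbar, fun x => by simp, h⟩

/-! ### Consequences of ∂R preserving su. -/

section Unitary

variable {F K k : Type*} [Field F] [Field K] [Field k] [Algebra F K] [Algebra F k]
    [Algebra K k] [IsScalarTower F K k] {n : ℕ} (conj : K ≃ₐ[F] K)

omit [IsScalarTower F K k] in
lemma su_map_conj (σ : k ≃ₐ[F] k)
    (hσ : ∀ x : K, σ (algebraMap K k x) = algebraMap K k (conj x)) (a : su n conj) :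
    ((a : Matrix (Fin n) (Fin n) K).map (algebraMap K k)).map (σ : k →+* k) =
      -((a : Matrix (Fin n) (Fin n) K).map (algebraMap K k)).transpose := by
  ext i j
  have h := congrFun (congrFun a.2.2 j) i
  simp only [Matrix.add_apply, Matrix.transpose_apply, Matrix.map_apply, Matrix.zero_apply] at h
  simp only [Matrix.map_apply, Matrix.neg_apply, Matrix.transpose_apply]
  rw [← map_neg, ← eq_neg_of_add_eq_zero_left h]
  exact hσ _

/-- Each leg contributes σ(a) = -aᵀ, and the two signs cancel. -/
lemma tensorConj_suTensor (σ : k ≃ₐ[F] k)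
    (hσ : ∀ x : K, σ (algebraMap K k x) = algebraMap K k (conj x))
    (t : (su n conj) ⊗[F] (su n conj)) :
    tensorConj n (σ : k →+* k) (suTensor k n conj t) =
      tensorTranspose n k (suTensor k n conj t) := by
  induction t using TensorProduct.induction_on with
  | zero => simp
  | add x y hx hy => simp only [map_add, hx, hy]
  | tmul a b =>
    have h : suTensor k n conj (a ⊗ₜ b) =
        (a : Matrix (Fin n) (Fin n) K).map (algebraMap K k) ⊗ₜ[k]
        (b : Matrix (Fin n) (Fin n) K).map (algebraMap K k) := rfl
    rw [h, tensorConj_tmul, su_map_conj conj σ hσ, su_map_conj conj σ hσ, tensorTranspose_tmul,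
      TensorProduct.neg_tmul, TensorProduct.tmul_neg, neg_neg]

omit [Algebra F k] [IsScalarTower F K k] in
/-- The unitary Lie algebra, together with the scalars, spans `gl_n`. -/
lemma mem_of_su_mem [CharZero K] [CharZero k] {s : K} (hs : s ≠ 0) (hconj : conj s = -s)
    (S : Submodule k (Matrix (Fin n) (Fin n) k)) (h1 : 1 ∈ S)
    (hS : ∀ a : su n conj, (a : Matrix (Fin n) (Fin n) K).map (algebraMap K k) ∈ S)
    (A : Matrix (Fin n) (Fin n) k) : A ∈ S := by
  have hmul : ∀ {c : k} {B : Matrix (Fin n) (Fin n) k}, c ≠ 0 → c • B ∈ S → B ∈ S :=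
    fun hc hB => (S.smul_mem_iff hc).mp hB
  have hneg : ∀ i j : Fin n, Matrix.single i j (-s) = -Matrix.single i j s := fun i j => by
    rw [← neg_one_smul K (Matrix.single i j s), Matrix.smul_single, neg_one_smul]
  have hs' : algebraMap K k s ≠ 0 := by simpa using hs
  -- For i ≠ j, su contains E_ij - E_ji and s(E_ij + E_ji); after division by s their sum is 2E_ij.
  have hoff : ∀ i j : Fin n, i ≠ j → Matrix.single i j (1 : k) ∈ S := by
    intro i j hij
    have ha : Matrix.single i j (1 : k) - Matrix.single j i (1 : k) ∈ S := by
      have h := hS ⟨Matrix.single i j 1 - Matrix.single j i 1, by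
        refine ⟨by simp [hij, hij.symm], ?_⟩
        rw [Matrix.map_sub _ (map_sub conj)]
        simp [Matrix.map_single]⟩
      rw [Matrix.map_sub _ (map_sub _)] at h
      simpa [Matrix.map_single] using h
    have hb : Matrix.single i j (1 : k) + Matrix.single j i (1 : k) ∈ S := by
      have h := hS ⟨Matrix.single i j s + Matrix.single j i s, by
        refine ⟨by simp [hij, hij.symm], ?_⟩
        rw [Matrix.map_add _ (map_add conj)]
        simp only [Matrix.map_single, hconj, Matrix.transpose_add, hneg, Matrix.transpose_neg,
          Matrix.transpose_single]
        abel⟩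
      rw [Matrix.map_add _ (map_add _)] at h
      refine hmul hs' ?_
      simpa only [Matrix.map_single, smul_add, Matrix.smul_single, smul_eq_mul, mul_one] using h
    refine hmul (two_ne_zero : (2 : k) ≠ 0) ?_
    rw [two_smul]
    convert S.add_mem ha hb using 1
    abel
  have hdiff : ∀ i j : Fin n, Matrix.single i i (1 : k) - Matrix.single j j (1 : k) ∈ S := by
    intro i j
    have h := hS ⟨Matrix.single i i s - Matrix.single j j s, by
        refine ⟨by simp, ?_⟩
        rw [Matrix.map_sub _ (map_sub conj)]
        simp only [Matrix.map_single, hconj, Matrix.transpose_sub, hneg, Matrix.transpose_neg,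
          Matrix.transpose_single]
        abel⟩
    rw [Matrix.map_sub _ (map_sub _)] at h
    refine hmul hs' ?_
    simpa only [Matrix.map_single, smul_sub, Matrix.smul_single, smul_eq_mul, mul_one] using h
  -- Trace-zero matrices alone cannot give E_ii; the identity supplies it through n·E_ii = ∑_j (E_ii
  -- - E_jj) + 1.
  have hdiag : ∀ i : Fin n, Matrix.single i i (1 : k) ∈ S := by
    intro i
    have hn : (n : k) ≠ 0 := Nat.cast_ne_zero.mpr (Fin.pos i).ne'
    refine hmul hn ?_
    have h : (n : k) • Matrix.single i i (1 : k) =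
        ∑ j : Fin n, (Matrix.single i i (1 : k) - Matrix.single j j (1 : k)) + 1 := by
      rw [Finset.sum_sub_distrib, Matrix.sum_single_one, sub_add_cancel]
      simp
    rw [h]
    exact S.add_mem (S.sum_mem fun j _ => hdiff i j) h1
  rw [Matrix.matrix_eq_sum_single A]
  refine S.sum_mem fun i _ => S.sum_mem fun j _ => ?_
  rw [← mul_one (A i j), ← smul_eq_mul, ← Matrix.smul_single]
  refine S.smul_mem _ ?_
  by_cases hij : i = j
  · subst hij; exact hdiag i
  · exact hoff i j hij

/-- Used with p = σ(R), q = R^{T⊗T}, u = σ(Δ(A)), v = Δ(Aᵀ). Transposition reverses products while σ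
does not, which gives the opposite order on the right; the sign in u = -v compensates. -/
lemma commute_sub_of_eq {A : Type*} [Ring A] {p q u v : A} (huv : u = -v)
    (h : p * u - u * p = v * q - q * v) : Commute (p - q) v := by
  rw [commute_iff_eq, ← sub_eq_zero]
  rw [huv, ← sub_eq_zero] at h
  rw [← neg_eq_zero, ← h]
  noncomm_ring

/-- If `∂R` maps `su` into `su ⊗ su`, then `σ(R) - R^{T ⊗ T}` is symmetric for each
automorphism `σ` inducing the conjugation. -/
lemma flipLinear_conj_sub_transpose [CharZero K] [CharZero k] {s : K} (hs : s ≠ 0)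
    (hconj : conj s = -s) (σ : k ≃ₐ[F] k)
    (hσ : ∀ x : K, σ (algebraMap K k x) = algebraMap K k (conj x)) (R : Mat2 n k)
    (hR : DefinesLieBialgebra conj R) :
    flipLinear n k (tensorConj n (σ : k →+* k) R - tensorTranspose n k R) =
      tensorConj n (σ : k →+* k) R - tensorTranspose n k R := by
  obtain ⟨δ, -, hδ⟩ := hR
  set D := tensorConj n (σ : k →+* k) R - tensorTranspose n k R with hD
  have key : ∀ a : su n conj,
      Commute D (diagTensor n k ((a : Matrix (Fin n) (Fin n) K).map (algebraMap K k)).transpose) := by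
    intro a
    set A := (a : Matrix (Fin n) (Fin n) K).map (algebraMap K k) with hA
    have h1 : coboundary R A = R * diagTensor n k A - diagTensor n k A * R := rfl
    have h2 := tensorConj_suTensor conj σ hσ (δ a)
    have h3 : tensorConj n (σ : k →+* k) (diagTensor n k A) = - diagTensor n k A.transpose := by
      simp only [diagTensor_apply, map_add, tensorConj_tmul]
      rw [hA, su_map_conj conj σ hσ]
      simp [TensorProduct.neg_tmul, TensorProduct.tmul_neg, Matrix.map_one]
      abel
    have h4 : tensorTranspose n k (diagTensor n k A) = diagTensor n k A.transpose := by
      simp [diagTensor_apply]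
    rw [hδ, ← hA, h1, map_sub, map_sub, tensorConj_mul, tensorConj_mul, tensorTranspose_mul,
      tensorTranspose_mul, h4] at h2
    exact commute_sub_of_eq h3 h2
  refine flipLinear_eq_self_of_commute D fun b => ?_
  -- The condition is linear in A and holds at A = 1 because Δ(1) is a scalar, so it passes from su
  -- to all matrices.
  let S : Submodule k (Matrix (Fin n) (Fin n) k) :=
    { carrier := {A | Commute D (diagTensor n k A.transpose)}
      zero_mem' := by simp
      add_mem' := fun ha hb => by
        simpa [Matrix.transpose_add, map_add] using Commute.add_right ha hb
      smul_mem' := fun c A hA => by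
        simpa [Matrix.transpose_smul, map_smul] using Commute.smul_right hA c }
  have hb : b.transpose ∈ S := by
    refine mem_of_su_mem conj hs hconj S ?_ key _
    change Commute D (diagTensor n k (Matrix.transpose 1))
    rw [Matrix.transpose_one, diagTensor_apply, ← Algebra.TensorProduct.one_def]
    exact (Commute.one_right D).add_right (Commute.one_right D)
  simpa [S] using hb

end Unitary

/-! ### The symmetric part of a Belavin–Drinfeld r-matrix. -/

section BelavinDrinfeld

variable {n : ℕ} {k : Type*} [Field k]

@[simp] lemma flipLinear_wedge (a b : Matrix (Fin n) (Fin n) k) :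
    flipLinear n k (wedge a b) = - wedge a b := by
  simp [wedge]

/-- The normalization tr(e_α e_{-α}) = 1 cancels the two constants. -/
lemma rootVector_tmul_swap {c : Fin n → Fin n → k} (hc : ∀ i j, i ≠ j → c i j * c j i = 1)
    {p : Fin n × Fin n} (hp : p.1 ≠ p.2) :
    rootVector c p ⊗ₜ[k] rootVector c p.swap =
      Matrix.single p.1 p.2 (1 : k) ⊗ₜ[k] Matrix.single p.2 p.1 (1 : k) := by
  have h : ∀ (i j : Fin n) (w : k), Matrix.single i j w = w • Matrix.single i j (1 : k) := by
    intros; simp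
  simp only [rootVector, Prod.fst_swap, Prod.snd_swap]
  rw [h _ _ (c p.1 p.2), h _ _ (c p.2 p.1), TensorProduct.smul_tmul_smul, hc _ _ hp, one_smul]

lemma sum_posRoots_add_flip :
    ∑ p ∈ posRoots n, (Matrix.single p.1 p.2 (1 : k) ⊗ₜ[k] Matrix.single p.2 p.1 (1 : k) +
      Matrix.single p.2 p.1 (1 : k) ⊗ₜ[k] Matrix.single p.1 p.2 (1 : k)) =
    permTensor n k - ∑ i : Fin n, Matrix.single i i (1 : k) ⊗ₜ[k] Matrix.single i i (1 : k) := by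
  set f : Fin n × Fin n → Mat2 n k :=
    fun p => Matrix.single p.1 p.2 (1 : k) ⊗ₜ[k] Matrix.single p.2 p.1 (1 : k) with hf
  have h1 : permTensor n k = ∑ p : Fin n × Fin n, f p := by
    rw [Fintype.sum_prod_type]; rfl
  have h2 : ∑ p ∈ posRoots n, f p.swap =
      ∑ p ∈ Finset.univ.filter (fun p : Fin n × Fin n => p.2 < p.1), f p := by
    refine Finset.sum_nbij' Prod.swap Prod.swap ?_ ?_ ?_ ?_ ?_ <;> simp [posRoots]
  have h3 : ∑ i : Fin n, Matrix.single i i (1 : k) ⊗ₜ[k] Matrix.single i i (1 : k) =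
      ∑ p ∈ Finset.univ.filter (fun p : Fin n × Fin n => p.1 = p.2), f p := by
    refine Finset.sum_nbij' (fun i => (i, i)) Prod.fst ?_ ?_ ?_ ?_ ?_ <;> simp [hf]
  rw [eq_sub_iff_add_eq, h1, h3]
  change ∑ p ∈ posRoots n, (f p + f p.swap) + _ = _
  rw [Finset.sum_add_distrib, h2, posRoots, add_assoc]
  rw [← Finset.sum_filter_add_sum_filter_not Finset.univ (fun p : Fin n × Fin n => p.1 < p.2)]
  congr 1
  rw [← Finset.sum_union]
  · refine Finset.sum_congr ?_ fun _ _ => rfl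
    ext p
    simp [le_iff_lt_or_eq, eq_comm]
  · rw [Finset.disjoint_filter]
    intro p _ h h'
    exact absurd h' h.ne'

/-- The symmetric part of a Belavin-Drinfeld `r`-matrix is the Casimir element. -/
lemma IsBelavinDrinfeld.add_flip {T : AdmissibleTriple n} {r : Mat2 n k}
    (h : IsBelavinDrinfeld T r) :
    r + flipLinear n k r = permTensor n k - (n : k)⁻¹ • 1 := by
  obtain ⟨c, r₀, hc, -, hr₀, -, rfl, -⟩ := h
  -- The wedges are skew, so the triple leaves no trace in the symmetric part.
  have h1 : bdRootPart T c + flipLinear n k (bdRootPart T c) =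
      permTensor n k - ∑ i : Fin n, Matrix.single i i (1 : k) ⊗ₜ[k] Matrix.single i i (1 : k) := by
    rw [← sum_posRoots_add_flip, bdRootPart, map_add, map_sum, map_sum]
    simp only [map_sum, flipLinear_wedge, Finset.sum_neg_distrib, flipLinear_tmul]
    rw [Finset.sum_add_distrib, Finset.sum_congr rfl fun p hp => rootVector_tmul_swap hc
      (Finset.mem_filter.mp hp).2.ne]
    have h2 : ∑ p ∈ posRoots n, rootVector c p.swap ⊗ₜ[k] rootVector c p = ∑ p ∈ posRoots n,
        Matrix.single p.2 p.1 (1 : k) ⊗ₜ[k] Matrix.single p.1 p.2 (1 : k) :=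
      Finset.sum_congr rfl fun p hp => rootVector_tmul_swap (p := p.swap) hc
        (Finset.mem_filter.mp hp).2.ne'
    rw [h2]
    abel
  rw [flip21_eq] at hr₀
  rw [map_add, add_add_add_comm, hr₀, h1, casimirCartan]
  abel

end BelavinDrinfeld

/-! ### First-leg images and stabilizers of the standard flag. -/

section Leg

variable {n : ℕ} {k : Type*} [Field k]

/-- The operator `x ↦ ∑ tr(b_i x) a_i` on matrices attached to a tensor `∑ a_i ⊗ b_i`. -/
def leg (n : ℕ) (k : Type*) [Field k] :
    Mat2 n k →ₗ[k] Matrix (Fin n) (Fin n) k →ₗ[k] Matrix (Fin n) (Fin n) k :=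
  TensorProduct.lift <| LinearMap.mk₂ k
    (fun a b => (((Matrix.traceLinearMap (Fin n) k k).comp (LinearMap.mulLeft k b)).smulRight a))
    (by intros; ext; simp [mul_add])
    (by intros; ext; simp [mul_left_comm])
    (by intros; ext; simp [add_mul])
    (by intros; ext; simp [mul_assoc])

lemma leg_tmul (a b x : Matrix (Fin n) (Fin n) k) :
    leg n k (a ⊗ₜ b) x = (b * x).trace • a := rfl

lemma leg_tmul_single (a b : Matrix (Fin n) (Fin n) k) (i j : Fin n) :
    leg n k (a ⊗ₜ b) (Matrix.single i j 1) = b j i • a := by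
  rw [leg_tmul]
  congr 1
  simp [Matrix.trace_mul_single]

/-- Together with `leg_mul_tmul`, this turns a conjugation of tensors by Y ⊗ Y into a conjugation of
their first-leg images by Y. -/
lemma leg_tmul_mul (a b : Matrix (Fin n) (Fin n) k) (r : Mat2 n k) (x : Matrix (Fin n) (Fin n) k) :
    leg n k (a ⊗ₜ b * r) x = a * leg n k r (x * b) := by
  induction r using TensorProduct.induction_on with
  | zero => simp
  | add r s hr hs => simp only [mul_add, map_add, LinearMap.add_apply, hr, hs]
  | tmul c d =>
    rw [Algebra.TensorProduct.tmul_mul_tmul, leg_tmul, leg_tmul, mul_smul_comm, mul_assoc,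
      Matrix.trace_mul_comm, mul_assoc]

lemma leg_mul_tmul (a b : Matrix (Fin n) (Fin n) k) (r : Mat2 n k) (x : Matrix (Fin n) (Fin n) k) :
    leg n k (r * a ⊗ₜ b) x = leg n k r (b * x) * a := by
  induction r using TensorProduct.induction_on with
  | zero => simp
  | add r s hr hs => simp only [add_mul, map_add, LinearMap.add_apply, hr, hs]
  | tmul c d =>
    rw [Algebra.TensorProduct.tmul_mul_tmul, leg_tmul, leg_tmul, smul_mul_assoc, mul_assoc]

lemma cartanTensor_induction {p : Mat2 n k → Prop} (h0 : p 0)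
    (hadd : ∀ r s, p r → p s → p (r + s))
    (ht : ∀ a b : Matrix (Fin n) (Fin n) k, a.IsDiag → b.IsDiag → p (a ⊗ₜ b))
    {r : Mat2 n k} (hr : r ∈ cartanTensor n k) : p r := by
  obtain ⟨t, rfl⟩ := hr
  induction t using TensorProduct.induction_on with
  | zero => simpa using h0
  | add x y hx hy => rw [map_add]; exact hadd _ _ hx hy
  | tmul a b => exact ht _ _ a.2.1 b.2.1

/-- The matrices that preserve the span of the basis vectors with index less than `m`. -/
def blockUpper (n : ℕ) (k : Type*) [Field k] (m : ℕ) :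
    Submodule k (Matrix (Fin n) (Fin n) k) where
  carrier := {A | ∀ i l : Fin n, m ≤ i.val → l.val < m → A i l = 0}
  zero_mem' := by simp
  add_mem' hA hB i l hi hl := by simp [hA i l hi hl, hB i l hi hl]
  smul_mem' c A hA i l hi hl := by simp [hA i l hi hl]

/-- The span of the basis vectors with index less than `m`. -/
def flagSubmodule (n : ℕ) (k : Type*) [Field k] (m : ℕ) : Submodule k (Fin n → k) where
  carrier := {v | ∀ i : Fin n, m ≤ i.val → v i = 0}
  zero_mem' := by simp
  add_mem' hv hw i hi := by simp [hv i hi, hw i hi]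
  smul_mem' c v hv i hi := by simp [hv i hi]

lemma mem_flagSubmodule {m : ℕ} {v : Fin n → k} :
    v ∈ flagSubmodule n k m ↔ ∀ i : Fin n, m ≤ i.val → v i = 0 := Iff.rfl

lemma flagSubmodule_mono {m m' : ℕ} (h : m ≤ m') : flagSubmodule n k m ≤ flagSubmodule n k m' :=
  fun _ hv i hi => hv i (h.trans hi)

lemma mulVec_mem_flagSubmodule {m : ℕ} {A : Matrix (Fin n) (Fin n) k} (hA : A ∈ blockUpper n k m)
    {v : Fin n → k} (hv : v ∈ flagSubmodule n k m) : A.mulVec v ∈ flagSubmodule n k m := by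
  intro i hi
  rw [Matrix.mulVec, dotProduct]
  refine Finset.sum_eq_zero fun l _ => ?_
  by_cases hl : l.val < m
  · rw [hA i l hi hl, zero_mul]
  · rw [hv l (not_lt.mp hl), mul_zero]

/-- A subspace stable under all strictly upper triangular matrices belongs to the standard flag. -/
lemma exists_eq_flagSubmodule (W : Submodule k (Fin n → k))
    (hW : ∀ i j : Fin n, i < j → ∀ v ∈ W, (Matrix.single i j (1 : k)).mulVec v ∈ W) :
    ∃ m, W = flagSubmodule n k m := by
  classical
  -- Take the least m with W inside the m-th flag member. If m = j + 1, some w in W has w_t ≠ 0 at t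
  -- = j; then E_it w = w_t e_i gives e_i for i < t, and removing these components from w leaves w_t
  -- e_t.
  have hex : ∃ m, W ≤ flagSubmodule n k m := ⟨n, fun v _ i hi => absurd i.2 (not_lt.mpr hi)⟩
  refine ⟨Nat.find hex, le_antisymm (Nat.find_spec hex) ?_⟩
  have hle := Nat.find_spec hex
  have hmin : ∀ m < Nat.find hex, ¬ W ≤ flagSubmodule n k m := fun m => Nat.find_min hex
  generalize Nat.find hex = m at hle hmin
  rcases m with _ | j
  · intro v hv
    have : v = 0 := funext fun i => hv i (Nat.zero_le _)
    rw [this]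
    exact W.zero_mem
  have hex' := hmin j (Nat.lt_succ_self j)
  rw [SetLike.not_le_iff_exists] at hex'
  obtain ⟨w, hw, hwj⟩ := hex'
  rw [mem_flagSubmodule] at hwj
  push Not at hwj
  obtain ⟨t, hjt, ht⟩ := hwj
  have htj : t.val = j := by
    by_contra h
    exact ht (hle hw t (by omega))
  have hlow : ∀ i : Fin n, i < t → Pi.single i (1 : k) ∈ W := by
    intro i hi
    have h := hW i t hi w hw
    have h' : (Matrix.single i t (1 : k)).mulVec w = w t • Pi.single i (1 : k) := by
      rw [Matrix.single_mulVec]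
      ext l
      simp [Function.update_apply, Pi.single_apply]
    rw [h'] at h
    exact (W.smul_mem_iff ht).mp h
  have htop : Pi.single t (1 : k) ∈ W := by
    rw [← W.smul_mem_iff ht]
    have h : w t • Pi.single t (1 : k) =
        w - ∑ i ∈ Finset.univ.filter (fun i => i < t), w i • (Pi.single i (1 : k) : Fin n → k) := by
      ext l
      simp only [Pi.smul_apply, Pi.sub_apply, Finset.sum_apply, Pi.single_apply, smul_eq_mul,
        mul_ite, mul_one, mul_zero, Finset.sum_ite_eq, Finset.mem_filter, Finset.mem_univ, true_and]
      rcases lt_trichotomy l t with h | h | h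
      · simp [h, h.ne]
      · simp [h]
      · have : w l = 0 := hle hw l (by omega)
        simp [h.ne', h.not_gt, this]
    rw [h]
    refine W.sub_mem hw (W.sum_mem fun i hi => W.smul_mem _ (hlow i ?_))
    simpa using hi
  intro v hv
  rw [pi_eq_sum_univ' v]
  refine W.sum_mem fun i _ => ?_
  rcases lt_trichotomy i t with h | h | h
  · exact W.smul_mem _ (hlow i h)
  · exact W.smul_mem _ (h ▸ htop)
  · rw [hv i (by omega), zero_smul]
    exact W.zero_mem

/-- If the image of `C` contains the strictly upper triangular matrices and is conjugate into the
stabilizer of a member of the standard flag, then it is contained in this stabilizer. -/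
lemma leg_mem_blockUpper_of_intertwine {B C : Mat2 n k} {m : ℕ} (Y : GL (Fin n) k)
    (hYBC : ((Y : Matrix (Fin n) (Fin n) k) ⊗ₜ[k] (Y : Matrix (Fin n) (Fin n) k)) * C =
      B * ((Y : Matrix (Fin n) (Fin n) k) ⊗ₜ[k] (Y : Matrix (Fin n) (Fin n) k)))
    (hB : ∀ x, leg n k B x ∈ blockUpper n k m)
    (hC : ∀ i j : Fin n, i < j → Matrix.single i j (1 : k) ∈ LinearMap.range (leg n k C))
    (x : Matrix (Fin n) (Fin n) k) : leg n k C x ∈ blockUpper n k m := by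
  have hinter : ∀ x, (Y : Matrix (Fin n) (Fin n) k) * leg n k C x =
      leg n k B ((Y : Matrix (Fin n) (Fin n) k) * (x * ((Y⁻¹ : GL (Fin n) k) :
        Matrix (Fin n) (Fin n) k))) * (Y : Matrix (Fin n) (Fin n) k) := by
    intro x
    rw [← leg_mul_tmul, ← hYBC, leg_tmul_mul, mul_assoc, Units.inv_mul, mul_one]
  set e : (Fin n → k) ≃ₗ[k] (Fin n → k) := Matrix.toLinearEquiv' (Y : Matrix (Fin n) (Fin n) k)
    (Matrix.invertibleOfIsUnitDet _ ((Matrix.isUnit_iff_isUnit_det _).mp Y.isUnit)) with he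
  have hev : ∀ v, e v = (Y : Matrix (Fin n) (Fin n) k).mulVec v := fun v => rfl
  -- W = Y⁻¹(flag member) is stable under the image of C, hence under all E_ij with i < j.
  set W : Submodule k (Fin n → k) := (flagSubmodule n k m).comap e.toLinearMap with hWdef
  have hW : ∀ x, ∀ v ∈ W, (leg n k C x).mulVec v ∈ W := by
    intro x v hv
    change e _ ∈ flagSubmodule n k m
    rw [hev, Matrix.mulVec_mulVec, hinter, ← Matrix.mulVec_mulVec]
    exact mulVec_mem_flagSubmodule (hB _) hv
  obtain ⟨m', hm'⟩ := exists_eq_flagSubmodule W (by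
    intro i j hij v hv
    obtain ⟨x, hx⟩ := hC i j hij
    rw [← hx]
    exact hW x v hv)
  have hrank : Module.finrank k W = Module.finrank k (flagSubmodule n k m) := by
    rw [hWdef, Submodule.comap_equiv_eq_map_symm]
    exact LinearEquiv.finrank_map_eq _ _
  -- m and m' may differ when both are at least n; nestedness and equal dimension still give
  -- equality of the subspaces.
  have hWm : W = flagSubmodule n k m := by
    rcases le_total m' m with h | h
    · exact Submodule.eq_of_le_of_finrank_eq (hm' ▸ flagSubmodule_mono h) hrank
    · exact (Submodule.eq_of_le_of_finrank_eq (hm' ▸ flagSubmodule_mono h) hrank.symm).symm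
  rw [hWm] at hW
  intro i l hi hl
  have h := hW x (Pi.single l 1) (fun i' hi' => by
    rw [Pi.single_apply, if_neg]
    rintro rfl
    omega) i hi
  simpa using h

end Leg

/-! ### The order on positive roots defined by τ. -/

section Root

variable {n : ℕ}

lemma mem_posRoots {p : Fin n × Fin n} : p ∈ posRoots n ↔ p.1 < p.2 := by simp [posRoots]

lemma mem_rootSupport {p : Fin n × Fin n} {l : Fin (n - 1)} :
    l ∈ rootSupport p ↔ p.1.val ≤ l.val ∧ l.val < p.2.val := by simp [rootSupport]

lemma rootSupport_nonempty {p : Fin n × Fin n} (hp : p.1 < p.2) : (rootSupport p).Nonempty :=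
  ⟨⟨p.1.val, by omega⟩, mem_rootSupport.mpr ⟨le_rfl, hp⟩⟩

lemma image_iterate_add {α : Type*} [DecidableEq α] (f : α → α) (a b : ℕ) (s : Finset α) :
    s.image f^[a + b] = (s.image f^[b]).image f^[a] := by
  rw [Finset.image_image, Function.iterate_add]

variable (T : AdmissibleTriple n)

lemma AdmissibleTriple.rootSupport_subset {p q : Fin n × Fin n} (h : T.Precedes p q) :
    rootSupport p ⊆ T.Γ₁ := by
  obtain ⟨m, hm, h, -⟩ := h
  simpa using h 0 hm

lemma AdmissibleTriple.precedes_trans {p q s : Fin n × Fin n} (h : T.Precedes p q)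
    (h' : T.Precedes q s) : T.Precedes p s := by
  obtain ⟨m, hm, hl, hq⟩ := h
  obtain ⟨m', hm', hl', hs⟩ := h'
  refine ⟨m' + m, by omega, fun l hlt => ?_, ?_⟩
  · by_cases h : l < m
    · exact hl l h
    · obtain ⟨t, rfl⟩ := Nat.exists_eq_add_of_le' (not_lt.mp h)
      rw [image_iterate_add, ← hq]
      exact hl' t (by omega)
  · rw [hs, hq, image_iterate_add]

/-- If a positive power of τ returned the support of p to itself, all iterates would stay in Γ₁,
against nilpotence. -/
lemma AdmissibleTriple.not_precedes_self {p : Fin n × Fin n} (hp : p.1 < p.2) :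
    ¬ T.Precedes p p := by
  rintro ⟨m, hm, hl, hq⟩
  have hall : ∀ N, (rootSupport p).image T.τ^[N] ⊆ T.Γ₁ := by
    intro N
    induction N using Nat.strong_induction_on with
    | _ N ih =>
      by_cases h : N < m
      · exact hl N h
      · obtain ⟨t, rfl⟩ := Nat.exists_eq_add_of_le' (not_lt.mp h)
        rw [image_iterate_add, ← hq]
        exact ih t (by omega)
  obtain ⟨i, hi⟩ := rootSupport_nonempty hp
  obtain ⟨N, hN⟩ := T.nilpotent i (by simpa using hall 0 (Finset.mem_image_of_mem _ hi))
  exact hN (hall N (Finset.mem_image_of_mem _ hi))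

/-- A strict order on a finite set; it drives the triangular induction in `single_mem_range_leg`. -/
lemma AdmissibleTriple.wellFounded_precedes :
    WellFounded fun p q : Fin n × Fin n => p.1 < p.2 ∧ T.Precedes p q := by
  have : IsTrans (Fin n × Fin n) fun p q => p.1 < p.2 ∧ T.Precedes p q :=
    ⟨fun _ _ _ h h' => ⟨h.1, T.precedes_trans h.2 h'.2⟩⟩
  have : Std.Irrefl fun p q : Fin n × Fin n => p.1 < p.2 ∧ T.Precedes p q :=
    ⟨fun _ h => T.not_precedes_self h.1 h.2⟩
  exact Finite.wellFounded_of_trans_of_irrefl _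

/-- If `Γ₂ ⊆ Γ₁`, then the triple is empty. -/
lemma AdmissibleTriple.eq_empty_of_subset (h : T.Γ₂ ⊆ T.Γ₁) : T.Γ₁ = ∅ ∧ T.Γ₂ = ∅ := by
  have hmaps : ∀ N, ∀ i ∈ T.Γ₁, T.τ^[N] i ∈ T.Γ₁ := by
    intro N
    induction N with
    | zero => exact fun i hi => hi
    | succ N ih => exact fun i hi => ih _ (h (T.bijOn.mapsTo hi))
  have h1 : T.Γ₁ = ∅ := by
    refine Finset.eq_empty_of_forall_notMem fun i hi => ?_
    obtain ⟨N, hN⟩ := T.nilpotent i hi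
    exact hN (hmaps N i hi)
  exact ⟨h1, Finset.subset_empty.mp (h1 ▸ h)⟩

end Root

/-! ### First-leg images of Belavin–Drinfeld r-matrices. -/

section RootPart

variable {n : ℕ} {k : Type*} [Field k] (T : AdmissibleTriple n)

lemma rootVector_apply (c : Fin n → Fin n → k) (p : Fin n × Fin n) (i j : Fin n) :
    rootVector c p i j = if p = (i, j) then c i j else 0 := by
  obtain ⟨a, b⟩ := p
  rw [rootVector, Matrix.single_apply]
  by_cases h : a = i ∧ b = j
  · obtain ⟨rfl, rfl⟩ := h
    simp
  · rw [if_neg h, if_neg]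
    simpa using h

lemma leg_wedge_single (a b : Matrix (Fin n) (Fin n) k) (i j : Fin n) :
    leg n k (wedge a b) (Matrix.single i j 1) = b j i • a - a j i • b := by
  rw [wedge, map_sub, LinearMap.sub_apply, leg_tmul_single, leg_tmul_single]

lemma rootVector_lower {c : Fin n → Fin n → k} {p : Fin n × Fin n} (hp : p ∈ posRoots n)
    {i j : Fin n} (hij : i < j) : rootVector c p j i = 0 := by
  rw [rootVector_apply, if_neg]
  rintro rfl
  exact absurd (mem_posRoots.mp hp) hij.not_gt

lemma rootVector_swap_upper {c : Fin n → Fin n → k} {p : Fin n × Fin n} (hp : p ∈ posRoots n)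
    {i j : Fin n} (hij : i < j) : rootVector c p.swap i j = 0 := by
  rw [rootVector_apply, if_neg]
  intro h
  rw [Prod.swap_eq_iff_eq_swap] at h
  subst h
  exact absurd (mem_posRoots.mp hp) hij.not_gt

-- Since tr(b E_ij) = b_ji, only terms with second leg e_{-α}, α = (i, j), survive: their first legs
-- are e_α and the e_p with p ≺ α.
open scoped Classical in
lemma leg_bdRootPart_upper (c : Fin n → Fin n → k) {i j : Fin n} (hij : i < j) :
    leg n k (bdRootPart T c) (Matrix.single i j 1) = c j i • rootVector c (i, j) +
      ∑ p ∈ (posRoots n).filter (fun p => T.Precedes p (i, j)), c j i • rootVector c p := by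
  have hswap : ∀ p : Fin n × Fin n, rootVector c p.swap j i = if p = (i, j) then c j i else 0 := by
    intro p
    rw [rootVector_apply]
    simp only [Prod.swap_eq_iff_eq_swap, Prod.swap_prod_mk]
  have hmem : (i, j) ∈ posRoots n := mem_posRoots.mpr hij
  rw [bdRootPart, map_add, LinearMap.add_apply, map_sum, map_sum, LinearMap.sum_apply,
    LinearMap.sum_apply]
  congr 1
  · simp only [leg_tmul_single, hswap, ite_smul, zero_smul, Finset.sum_ite_eq', hmem, if_true]
  · rw [Finset.sum_filter]
    refine Finset.sum_congr rfl fun p hp => ?_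
    rw [map_sum, LinearMap.sum_apply]
    simp only [leg_wedge_single, hswap, rootVector_lower hp hij, zero_smul, sub_zero, ite_smul,
      Finset.sum_ite_eq', Finset.mem_filter, hmem, true_and]

-- Here the second leg must be e_α with α = (i, j) positive, which occurs only in the half -e_{-q} ⊗
-- e_α of a wedge with α ≺ q. So the negative root vectors obtained have support in Γ₂.
open scoped Classical in
lemma leg_bdRootPart_lower (c : Fin n → Fin n → k) {i j : Fin n} (hij : i < j) :
    leg n k (bdRootPart T c) (Matrix.single j i 1) =
      -∑ q ∈ (posRoots n).filter (fun q => T.Precedes (i, j) q), c i j • rootVector c q.swap := by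
  have hmem : (i, j) ∈ posRoots n := mem_posRoots.mpr hij
  rw [bdRootPart, map_add, LinearMap.add_apply, map_sum, map_sum, LinearMap.sum_apply,
    LinearMap.sum_apply]
  rw [Finset.sum_eq_zero, zero_add]
  · rw [Finset.sum_eq_single (i, j)]
    · rw [map_sum, LinearMap.sum_apply, ← Finset.sum_neg_distrib]
      refine Finset.sum_congr rfl fun q hq => ?_
      rw [leg_wedge_single, rootVector_swap_upper (Finset.mem_filter.mp hq).1 hij,
        rootVector_apply, if_pos rfl, zero_smul, zero_sub]
    · intro p _ hp
      rw [map_sum, LinearMap.sum_apply]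
      refine Finset.sum_eq_zero fun q hq => ?_
      rw [leg_wedge_single, rootVector_swap_upper (Finset.mem_filter.mp hq).1 hij,
        rootVector_apply, if_neg hp, zero_smul, zero_smul, sub_zero]
    · exact fun h => absurd hmem h
  · intro p hp
    rw [leg_tmul_single, rootVector_swap_upper hp hij, zero_smul]

lemma leg_cartanTensor_single {r₀ : Mat2 n k} (hr₀ : r₀ ∈ cartanTensor n k) {i j : Fin n}
    (hij : i ≠ j) : leg n k r₀ (Matrix.single i j 1) = 0 := by
  refine cartanTensor_induction (p := fun r => leg n k r (Matrix.single i j 1) = 0) ?_ ?_ ?_ hr₀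
  · simp
  · intro r s hr hs
    rw [map_add, LinearMap.add_apply, hr, hs, add_zero]
  · intro a b _ hb
    rw [leg_tmul_single, hb hij.symm, zero_smul]

/-- The image of a Belavin-Drinfeld `r`-matrix contains all positive root vectors. -/
lemma single_mem_range_leg {c : Fin n → Fin n → k} (hc : ∀ i j, i ≠ j → c i j ≠ 0)
    {r₀ : Mat2 n k} (hr₀ : r₀ ∈ cartanTensor n k) (p : Fin n × Fin n) (hp : p.1 < p.2) :
    Matrix.single p.1 p.2 (1 : k) ∈ LinearMap.range (leg n k (r₀ + bdRootPart T c)) := by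
  classical
  induction p using T.wellFounded_precedes.induction with
  | _ p ih =>
    set I := LinearMap.range (leg n k (r₀ + bdRootPart T c)) with hI
    have hroot : ∀ q : Fin n × Fin n, Matrix.single q.1 q.2 (1 : k) ∈ I → rootVector c q ∈ I := by
      intro q hq
      have h := I.smul_mem (c q.1 q.2) hq
      rwa [Matrix.smul_single, smul_eq_mul, mul_one] at h
    have h := leg_bdRootPart_upper T c hp
    have h0 : leg n k (r₀ + bdRootPart T c) (Matrix.single p.1 p.2 1) =
        leg n k (bdRootPart T c) (Matrix.single p.1 p.2 1) := by
      rw [map_add, LinearMap.add_apply, leg_cartanTensor_single hr₀ hp.ne, zero_add]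
    rw [← h0] at h
    -- Triangularity: the value at E_p is a nonzero multiple of e_p plus multiples of e_q with q ≺
    -- p, already in the image by induction.
    have hsum : ∑ q ∈ (posRoots n).filter (fun q => T.Precedes q p),
        c p.2 p.1 • rootVector c q ∈ I := by
      refine I.sum_mem fun q hq => I.smul_mem _ (hroot q ?_)
      rw [Finset.mem_filter, mem_posRoots] at hq
      exact ih q hq hq.1
    have hmem : c p.2 p.1 • rootVector c p ∈ I := (I.add_mem_iff_left hsum).mp ⟨_, h⟩
    rw [I.smul_mem_iff (hc _ _ hp.ne')] at hmem
    rw [← I.smul_mem_iff (hc _ _ hp.ne), Matrix.smul_single, smul_eq_mul, mul_one]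
    exact hmem

/-- If the image of a Belavin-Drinfeld `r`-matrix stabilizes the member of dimension `m + 1` of
the standard flag, then `α_m` is not in `Γ₂`. -/
lemma notMem_of_leg_mem_blockUpper {c : Fin n → Fin n → k} (hc : ∀ i j, i ≠ j → c i j ≠ 0)
    {r₀ : Mat2 n k} (hr₀ : r₀ ∈ cartanTensor n k) (m : Fin (n - 1))
    (h : ∀ x, leg n k (r₀ + bdRootPart T c) x ∈ blockUpper n k (m.val + 1)) : m ∉ T.Γ₂ := by
  classical
  intro hm
  obtain ⟨a, ha, ham⟩ := T.bijOn.surjOn hm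
  have hsupp : ∀ l : Fin (n - 1),
      rootSupport ((⟨l.val, by omega⟩, ⟨l.val + 1, by omega⟩) : Fin n × Fin n) = {l} := by
    intro l
    ext t
    rw [mem_rootSupport, Finset.mem_singleton, Fin.ext_iff]
    simp only
    omega
  set i : Fin n := ⟨a.val, by omega⟩ with hi
  set j : Fin n := ⟨a.val + 1, by omega⟩ with hj
  set s : Fin n := ⟨m.val, by omega⟩ with hs
  set t : Fin n := ⟨m.val + 1, by omega⟩ with ht
  have hij : i < j := Fin.lt_def.mpr (Nat.lt_succ_self _)
  have hst : s < t := Fin.lt_def.mpr (Nat.lt_succ_self _)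
  have hprec : T.Precedes (i, j) (s, t) := by
    refine ⟨1, le_rfl, fun l hl => ?_, ?_⟩
    · obtain rfl : l = 0 := by omega
      rw [hsupp a]
      simpa using ha
    · rw [hsupp a, hsupp m]
      simp [ham]
  -- Row m + 1, column m isolates the term q = α_m = τ(α_a). Its coefficient is nonzero, yet this
  -- entry lies in the block that must vanish.
  have h1 := h (Matrix.single j i 1) t s le_rfl (Nat.lt_succ_self _)
  rw [map_add, LinearMap.add_apply, leg_cartanTensor_single hr₀ hij.ne', zero_add,
    leg_bdRootPart_lower T c hij, Matrix.neg_apply, neg_eq_zero, Matrix.sum_apply,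
    Finset.sum_eq_single (s, t)] at h1
  · rw [Matrix.smul_apply, rootVector_apply, Prod.swap_prod_mk, if_pos rfl, smul_eq_mul] at h1
    exact mul_ne_zero (hc _ _ hij.ne) (hc _ _ hst.ne') h1
  · intro q _ hq
    rw [Matrix.smul_apply, rootVector_apply, if_neg, smul_zero]
    rwa [Prod.swap_eq_iff_eq_swap]
  · intro hn
    exact absurd (Finset.mem_filter.mpr ⟨mem_posRoots.mpr hst, hprec⟩) hn

/-- The flipped and transposed `r`-matrix stabilizes the member of dimension `m + 1` of the
standard flag if `α_m` is not in `Γ₁`. -/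
lemma leg_transpose_flip_mem_blockUpper (c : Fin n → Fin n → k)
    {r₀ : Mat2 n k} (hr₀ : r₀ ∈ cartanTensor n k) (m : Fin (n - 1)) (hm : m ∉ T.Γ₁)
    (x : Matrix (Fin n) (Fin n) k) :
    leg n k (tensorTranspose n k (flipLinear n k (r₀ + bdRootPart T c))) x ∈
      blockUpper n k (m.val + 1) := by
  classical
  set Φ : Mat2 n k →ₗ[k] Matrix (Fin n) (Fin n) k :=
    (leg n k).flip x ∘ₗ tensorTranspose n k ∘ₗ flipLinear n k with hΦ
  change Φ (r₀ + bdRootPart T c) ∈ _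
  -- After flip and transpose the first leg is the transpose of the old second leg: e_{-α} becomes
  -- upper triangular, and e_p with support in Γ₁ could leave the flag member only if α_m were in
  -- that support.
  have htmul : ∀ a b : Matrix (Fin n) (Fin n) k, b.transpose ∈ blockUpper n k (m.val + 1) →
      Φ (a ⊗ₜ b) ∈ blockUpper n k (m.val + 1) :=
    fun a b hb => Submodule.smul_mem _ _ hb
  have hneg : ∀ p ∈ posRoots n,
      (rootVector c p.swap).transpose ∈ blockUpper n k (m.val + 1) := by
    intro p hp i l hi hl
    exact rootVector_swap_upper hp (Fin.lt_def.mpr (by omega))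
  have hpos : ∀ p : Fin n × Fin n, rootSupport p ⊆ T.Γ₁ →
      (rootVector c p).transpose ∈ blockUpper n k (m.val + 1) := by
    intro p hp i l hi hl
    rw [Matrix.transpose_apply, rootVector_apply, if_neg]
    rintro rfl
    exact hm (hp (mem_rootSupport.mpr ⟨by simp only; omega, by simp only; omega⟩))
  rw [map_add]
  refine Submodule.add_mem _ ?_ ?_
  · refine cartanTensor_induction (p := fun r => Φ r ∈ blockUpper n k (m.val + 1)) ?_ ?_ ?_ hr₀
    · simp
    · intro r s hr hs
      rw [map_add]
      exact Submodule.add_mem _ hr hs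
    · intro a b _ hb
      refine htmul a b fun i l hi hl => hb ?_
      rintro rfl
      omega
  · rw [bdRootPart, map_add, map_sum, map_sum]
    refine Submodule.add_mem _ (Submodule.sum_mem _ fun p hp => htmul _ _ (hneg p hp))
      (Submodule.sum_mem _ fun p _ => ?_)
    rw [map_sum]
    refine Submodule.sum_mem _ fun q hq => ?_
    rw [Finset.mem_filter] at hq
    rw [wedge, map_sub]
    exact Submodule.sub_mem _ (htmul _ _ (hneg q hq.1))
      (htmul _ _ (hpos p (T.rootSupport_subset hq.2)))

lemma tensorConj_mem_cartanTensor (σ : k →+* k) {r₀ : Mat2 n k} (hr₀ : r₀ ∈ cartanTensor n k) :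
    tensorConj n σ r₀ ∈ cartanTensor n k := by
  obtain ⟨t, rfl⟩ := hr₀
  have hmap : ∀ a ∈ cartan n k, a.map σ ∈ cartan n k := by
    intro a ha
    refine ⟨ha.1.map (map_zero σ), ?_⟩
    have h := congrArg σ ha.2
    rw [map_zero] at h
    rw [← h]
    simp [Matrix.trace]
  induction t using TensorProduct.induction_on with
  | zero => simp
  | add x y hx hy => rw [map_add, map_add]; exact Submodule.add_mem _ hx hy
  | tmul a b => exact ⟨⟨_, hmap a a.2⟩ ⊗ₜ ⟨_, hmap b b.2⟩, rfl⟩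

/-- σ changes only the constants of the root vectors, so σ(r) keeps the same triple. -/
lemma tensorConj_bdRootPart (σ : k →+* k) (c : Fin n → Fin n → k) :
    tensorConj n σ (bdRootPart T c) = bdRootPart T (fun i j => σ (c i j)) := by
  have h : ∀ p, (rootVector c p).map σ = rootVector (fun i j => σ (c i j)) p := by
    intro p
    rw [rootVector, Matrix.map_single]
    rfl
  simp only [bdRootPart, wedge, map_add, map_sum, map_sub, tensorConj_tmul, h]

/-- For the empty triple, a Belavin-Drinfeld `r`-matrix differs from the Drinfeld-Jimbo one by a
skew-symmetric Cartan part. -/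
lemma IsBelavinDrinfeld.eq_add_drinfeldJimbo [CharZero k] {T : AdmissibleTriple n} {r : Mat2 n k}
    (h : IsBelavinDrinfeld T r) (hT : T.Γ₁ = ∅) :
    ∃ rs ∈ cartanTensor n k, rs + flip21 rs = 0 ∧ r = rs + drinfeldJimbo n k := by
  classical
  obtain ⟨c, r₀, hc, hr₀, hflip, -, rfl, -⟩ := h
  have hroot : bdRootPart T c =
      ∑ p ∈ posRoots n, Matrix.single p.1 p.2 (1 : k) ⊗ₜ[k] Matrix.single p.2 p.1 (1 : k) := by
    rw [bdRootPart, Finset.sum_congr rfl fun p hp => rootVector_tmul_swap hc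
      (mem_posRoots.mp hp).ne, add_eq_left]
    refine Finset.sum_eq_zero fun p hp => Finset.sum_eq_zero fun q hq => ?_
    obtain ⟨i, hi⟩ := rootSupport_nonempty (mem_posRoots.mp hp)
    have := T.rootSupport_subset (Finset.mem_filter.mp hq).2 hi
    simp [hT] at this
  have hflipmem : flip21 r₀ ∈ cartanTensor n k := by
    clear hflip
    obtain ⟨t, rfl⟩ := hr₀
    refine ⟨TensorProduct.comm k _ _ t, ?_⟩
    induction t using TensorProduct.induction_on with
    | zero => simp [flip21]
    | add x y hx hy =>
      rw [map_add, map_add, hx, hy, map_add]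
      exact (map_add (flipLinear n k) _ _).symm
    | tmul a b => rfl
  rw [flip21_eq] at hflip hflipmem
  -- As Ω₀ = r₀ + r₀²¹, this witness is the skew part of r₀; the same identity puts Ω₀ in 𝔥 ⊗ 𝔥.
  refine ⟨r₀ - (2 : k)⁻¹ • casimirCartan n k, ?_, ?_, ?_⟩
  · rw [← hflip]
    exact Submodule.sub_mem _ hr₀ (Submodule.smul_mem _ _ (Submodule.add_mem _ hr₀ hflipmem))
  · have h2 : flipLinear n k (casimirCartan n k) = casimirCartan n k := by
      rw [← hflip, map_add, flipLinear_flipLinear, add_comm]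
    have h3 : (2 : k)⁻¹ • casimirCartan n k + (2 : k)⁻¹ • casimirCartan n k =
        casimirCartan n k := by
      rw [← add_smul, ← two_mul, mul_inv_cancel₀ two_ne_zero, one_smul]
    rw [flip21_eq, map_sub, map_smul, h2, sub_add_sub_comm, hflip, h3, sub_self]
  · rw [hroot, drinfeldJimbo]
    abel

end RootPart

/-! ### The matrix Xᵀσ(X) as an intertwiner. -/

section Intertwiner

variable {n : ℕ} {k : Type*} [Field k] [CharZero k]

/-- Used with a = σ(R), b = R^{T⊗T} and primes for flips: the first two equations give a + b = -(a'
+ b'), and adding a - b = a' - b' yields 2a = -2b'. -/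
lemma add_self_eq_of_add_eq {M : Type*} [AddCommGroup M] {a a' b b' z : M} (h1 : a + a' = -z)
    (h2 : b + b' = z) (h : a' - b' = a - b) : a + a = -b' + -b' := by
  have e : a + a = (a + a') + (b + b') - (a' - b' - (a - b)) - b' - b' := by abel
  rw [e, h1, h2, h]
  abel

/-- If `σ(√d' Ad_X r) - (√d' Ad_X r)^{T ⊗ T}` is symmetric and `σ(√d') = -√d'`, then `Xᵀ σ(X)`
intertwines `σ(r)` and the flipped transpose of `r`. -/
lemma intertwine_of_symmetric (σ : k →+* k) {s : k} (hs : s ≠ 0) (hσs : σ s = -s)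
    (X : GL (Fin n) k) {r : Mat2 n k}
    (hr : r + flipLinear n k r = permTensor n k - (n : k)⁻¹ • 1)
    (hD : flipLinear n k (tensorConj n σ (s • adAd X r) - tensorTranspose n k (s • adAd X r)) =
      tensorConj n σ (s • adAd X r) - tensorTranspose n k (s • adAd X r)) :
    ∃ Y : GL (Fin n) k,
      ((Y : Matrix (Fin n) (Fin n) k) ⊗ₜ[k] (Y : Matrix (Fin n) (Fin n) k)) * tensorConj n σ r =
      tensorTranspose n k (flipLinear n k r) *
        ((Y : Matrix (Fin n) (Fin n) k) ⊗ₜ[k] (Y : Matrix (Fin n) (Fin n) k)) := by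
  set R := s • adAd X r with hR
  set Z := permTensor n k - (n : k)⁻¹ • (1 : Mat2 n k) with hZ
  have hRZ : R + flipLinear n k R = s • Z := by
    rw [hR, map_smul, flipLinear_adAd, ← smul_add, ← adAd_add, hr, hZ,
      adAd_sub, adAd_smul, adAd_one, adAd_permTensor]
  have hσZ : tensorConj n σ (s • Z) = -(s • Z) := by
    rw [LinearMap.map_smulₛₗ, hσs, hZ, map_sub, LinearMap.map_smulₛₗ]
    simp
  have hTZ : tensorTranspose n k (s • Z) = s • Z := by
    rw [map_smul, hZ, map_sub, map_smul]
    simp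
  have h1 : tensorConj n σ R + flipLinear n k (tensorConj n σ R) = -(s • Z) := by
    rw [flipLinear_tensorConj, ← map_add, hRZ, hσZ]
  have h2 : tensorTranspose n k R + flipLinear n k (tensorTranspose n k R) = s • Z := by
    rw [flipLinear_tensorTranspose, ← map_add, hRZ, hTZ]
  have h3 : tensorConj n σ R = -tensorTranspose n k (flipLinear n k R) := by
    rw [← flipLinear_tensorTranspose]
    rw [map_sub] at hD
    have h4 : (2 : k) • tensorConj n σ R =
        (2 : k) • (-flipLinear n k (tensorTranspose n k R)) := by
      rw [two_smul, two_smul]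
      exact add_self_eq_of_add_eq h1 h2 hD
    exact smul_right_injective _ (two_ne_zero : (2 : k) ≠ 0) h4
  -- The minus sign in `h3` is absorbed by σ(s) = -s; this is where the sign change of √d' matters.
  have h5 : tensorConj n σ (adAd X r) = tensorTranspose n k (flipLinear n k (adAd X r)) := by
    rw [hR, LinearMap.map_smulₛₗ, hσs, map_smul, map_smul, neg_smul, neg_inj] at h3
    exact smul_right_injective _ hs h3
  rw [flipLinear_adAd, adAd, adAd, tensorConj_mul, tensorConj_mul, tensorTranspose_mul,
    tensorTranspose_mul, tensorConj_tmul, tensorConj_tmul, tensorTranspose_tmul,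
    tensorTranspose_tmul] at h5
  set x := (X : Matrix (Fin n) (Fin n) k) with hx
  set y := ((X⁻¹ : GL (Fin n) k) : Matrix (Fin n) (Fin n) k) with hy
  have hxy : x * y = 1 := Units.mul_inv X
  have hyx : y * x = 1 := Units.inv_mul X
  have h6 : y.map σ * x.map σ = 1 := by
    rw [← Matrix.map_mul, hyx, Matrix.map_one _ (map_zero σ) (map_one σ)]
  have h7 : x.map σ * y.map σ = 1 := by
    rw [← Matrix.map_mul, hxy, Matrix.map_one _ (map_zero σ) (map_one σ)]
  have h8 : x.transpose * y.transpose = 1 := by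
    rw [← Matrix.transpose_mul, hyx, Matrix.transpose_one]
  have h9 : y.transpose * x.transpose = 1 := by
    rw [← Matrix.transpose_mul, hxy, Matrix.transpose_one]
  -- Multiplying `h5` by Xᵀ ⊗ Xᵀ on the left and σ(X) ⊗ σ(X) on the right leaves Y = Xᵀσ(X) on both
  -- sides.
  refine ⟨⟨x.transpose * x.map σ, y.map σ * y.transpose, ?_, ?_⟩, ?_⟩
  · rw [mul_assoc, ← mul_assoc (x.map σ), h7, one_mul, h8]
  · rw [mul_assoc, ← mul_assoc y.transpose, h9, one_mul, h6]
  · have h10 := congrArg (fun t => (x.transpose ⊗ₜ[k] x.transpose) * t *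
      (x.map σ ⊗ₜ[k] x.map σ)) h5
    simp only [mul_assoc, Algebra.TensorProduct.tmul_mul_tmul, h6] at h10
    simp only [← mul_assoc, Algebra.TensorProduct.tmul_mul_tmul, h8] at h10
    simpa only [← Algebra.TensorProduct.one_def, mul_one, one_mul] using h10

end Intertwiner

end

/-! ### The main theorem. -/

theorem mainTheorem12
    {F K Fbar : Type*} [Field F] [CharZero F] [Field K] [Algebra F K]
    [Field Fbar] [Algebra F Fbar] [IsAlgClosure F Fbar] [Algebra K Fbar] [IsScalarTower F K Fbar]
    (d : F) (hd : ¬ IsSquare d)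
    (sqrtd : K) (hsqrtd : sqrtd ^ 2 = algebraMap F K d)
    (hK : IntermediateField.adjoin F {sqrtd} = ⊤)
    (conj : K ≃ₐ[F] K) (hconj : conj sqrtd = -sqrtd)
    (n : ℕ)
    (d' : F) (sqrtd' : Fbar) (hsqrtd' : sqrtd' ^ 2 = algebraMap F Fbar d')
    (hd' : sqrtd' ∉ Set.range (algebraMap K Fbar))
    (X : GL (Fin n) Fbar)
    (T : AdmissibleTriple n) (rBD : Mat2 n Fbar) (hBD : IsBelavinDrinfeld T rBD)
    (hr : DefinesLieBialgebra conj (sqrtd' • adAd X rBD)) :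
    (T.Γ₁ = ∅ ∧ T.Γ₂ = ∅) ∧
      ∃ rs ∈ cartanTensor n Fbar, rs + flip21 rs = 0 ∧ rBD = rs + drinfeldJimbo n Fbar := by
  have : CharZero K := charZero_of_injective_algebraMap (algebraMap F K).injective
  have : CharZero Fbar := charZero_of_injective_algebraMap (algebraMap F Fbar).injective
  have hT : T.Γ₁ = ∅ ∧ T.Γ₂ = ∅ := by
    obtain ⟨σ, hσ, hσd'⟩ := exists_algEquiv_extending conj d' sqrtd' hsqrtd' hd'
    have hs : sqrtd ≠ 0 := by
      rintro rfl
      rw [zero_pow two_ne_zero, eq_comm, map_eq_zero] at hsqrtd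
      exact hd (hsqrtd ▸ IsSquare.zero)
    have hs' : sqrtd' ≠ 0 := by
      rintro rfl
      exact hd' ⟨0, map_zero _⟩
    obtain ⟨Y, hY⟩ := intertwine_of_symmetric (σ : Fbar →+* Fbar) hs' hσd' X hBD.add_flip
      (flipLinear_conj_sub_transpose conj hs hconj σ hσ _ hr)
    obtain ⟨c, r₀, hc, hr₀, -, -, rfl, -⟩ := hBD
    have hc' : ∀ i j, i ≠ j → (σ : Fbar →+* Fbar) (c i j) ≠ 0 := fun i j hij =>
      (map_ne_zero _).mpr (left_ne_zero_of_mul_eq_one (hc i j hij))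
    have hr₀' := tensorConj_mem_cartanTensor (σ : Fbar →+* Fbar) hr₀
    -- If α_m were in Γ₂ but not in Γ₁, the flag member of dimension m + 1 would be stable for the
    -- flipped transpose of r, hence through Y for σ(r), which α_m ∈ Γ₂ forbids.
    refine T.eq_empty_of_subset fun m hm => ?_
    by_contra hm1
    refine notMem_of_leg_mem_blockUpper T hc' hr₀' m ?_ hm
    rw [← tensorConj_bdRootPart, ← map_add]
    refine leg_mem_blockUpper_of_intertwine Y hY
      (leg_transpose_flip_mem_blockUpper T c hr₀ m hm1) fun i j hij => ?_
    rw [map_add, tensorConj_bdRootPart]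
    exact single_mem_range_leg T hc' hr₀' (i, j) hij
  exact ⟨hT, hBD.eq_add_drinfeldJimbo hT.1⟩
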